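/- Let $n>d\ge 0$ be integers and let $\beta_0\in\mathbb{R}$, $\beta\in\mathbb{R}^d$. Let $x_1,\dots,x_n$ be i.i.d. $N(0,I_d)$ random vectors, put $\bar x_i=(1,x_i^\top)^\top\in\mathbb{R}^{d+1}$, and let $y_1,\dots,y_n$ be $\{-1,1\}$-valued random variables that, given $(x_1,\dots,x_n)$, are conditionally independent with $\mathbb{P}(y_i=1\mid x_1,\dots,x_n)=\Phi(\beta_0+x_i\cdot\beta)$ a.s. for every $i$, where $\Phi$ is the standard normal c.d.f. Let $\gamma_0\ge 0$ be such that $\gamma_0^2=\operatorname{Var}(x_i\cdot\beta)$, and set $$s^*=\inf_{u\in\mathbb{R}^{d+1},\,|u|=1}\ \sum_{i=1}^n \mathbf 1_{(-\infty,0]}(y_i\,\bar x_i\cdot u),\qquad h=\mathbb{E}\big[\Phi(-|\beta_0+\gamma_0 Z|)\big],\quad Z\sim N(0,1).$$ Then $h>0$ and, for every $\epsilon>0$, with probability at least $1-\exp(-2\epsilon^2 n)$, $$s^*\ \ge\ n\left(h-\epsilon-\left(\frac{2\ln(en/(d+1))}{n/(d+1)}\right)^{1/2}\right).$$ -/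

import Mathlib

open MeasureTheory ProbabilityTheory

namespace Probit

/-- The cumulative distribution function `Φ` of the standard normal distribution. -/
noncomputable def Phi (t : ℝ) : ℝ := cdf (gaussianReal 0 1) t

/-- The vector `(a, vᵀ)ᵀ ∈ ℝ^{d+1}` for `a ∈ ℝ` and `v ∈ ℝ^d`. -/
noncomputable def consVec {d : ℕ} (a : ℝ) (v : EuclideanSpace ℝ (Fin d)) :
    EuclideanSpace ℝ (Fin (d + 1)) :=
  WithLp.toLp 2 (Fin.cons a (fun j => v j))

/-- The covariate vector with intercept, `x̄ = (1, xᵀ)ᵀ`. -/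
noncomputable def withIntercept {d : ℕ} (x : EuclideanSpace ℝ (Fin d)) :
    EuclideanSpace ℝ (Fin (d + 1)) :=
  consVec 1 x

/-- `s* = inf_{u ∈ 𝕊^d} ∑_i 1_{(-∞,0]}(y_i x̄_i · u)`, where `𝕊^d` is the unit sphere of `ℝ^{d+1}`. -/
noncomputable def sStar {n d : ℕ} (xbar : Fin n → EuclideanSpace ℝ (Fin (d + 1)))
    (y : Fin n → ℝ) : ℝ :=
  ⨅ u : Metric.sphere (0 : EuclideanSpace ℝ (Fin (d + 1))) 1,
    ∑ i, (Set.Iic (0 : ℝ)).indicator (fun _ => (1 : ℝ)) (y i * inner ℝ (xbar i) u.1)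

/-- The σ-algebra generated by the family `(x_i)_i`. -/
abbrev sigmaAlg {Ω ι E : Type*} [MeasurableSpace E] (x : ι → Ω → E) : MeasurableSpace Ω :=
  MeasurableSpace.comap (fun ω i => x i ω) inferInstance

/-- Conditional independence of real random variables `(y_i)_i` given a σ-algebra `m`:
conditional probabilities given `m` of finite intersections factorize almost surely. (On standard
Borel spaces this is the criterion `iCondIndepFun_iff_condExp_inter_preimage_eq_mul` for Mathlib's `iCondIndepFun`, whose
definition is restricted to such spaces.) -/
def CondIndepGiven {Ω ι : Type*} (m : MeasurableSpace Ω) [MeasurableSpace Ω] (μ : Measure Ω)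
    (y : ι → Ω → ℝ) : Prop :=
  ∀ (S : Finset ι) (B : ι → Set ℝ), (∀ i, MeasurableSet (B i)) →
    μ⟦⋂ i ∈ S, y i ⁻¹' B i | m⟧ =ᵐ[μ] ∏ i ∈ S, μ⟦y i ⁻¹' B i | m⟧

/-- The well-specified probit model with intercept, standard Gaussian design and true parameter
`(β₀, βᵀ)ᵀ`. -/
structure IsProbitModel {Ω : Type*} [MeasurableSpace Ω] (μ : Measure Ω) {n d : ℕ}
    (β₀ : ℝ) (β : EuclideanSpace ℝ (Fin d))
    (x : Fin n → Ω → EuclideanSpace ℝ (Fin d)) (y : Fin n → Ω → ℝ) : Prop where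
  measurable_x : ∀ i, Measurable (x i)
  measurable_y : ∀ i, Measurable (y i)
  /-- The covariates are independent. -/
  indep_x : iIndepFun x μ
  /-- Each `x_i` has law `N(0, I_d)`. -/
  law_x : ∀ i, μ.map (x i) = stdGaussian (EuclideanSpace ℝ (Fin d))
  /-- The responses take values in `{-1, 1}`. -/
  range_y : ∀ i, ∀ᵐ ω ∂μ, y i ω = -1 ∨ y i ω = 1
  /-- The responses are conditionally independent given the covariates. -/
  condIndep_y : CondIndepGiven (sigmaAlg x) μ y
  /-- Given the covariates, `(y_i + 1) / 2` is Bernoulli with parameter `Φ(x̄_i · (β₀, βᵀ)ᵀ)`. -/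
  law_y : ∀ i, μ⟦y i ⁻¹' {1} | sigmaAlg x⟧ =ᵐ[μ]
    fun ω => Phi (inner ℝ (withIntercept (x i ω)) (consVec β₀ β))

/-- `h = E[Φ(-|β₀ + γ₀ Z|)]` with `Z ∼ N(0,1)`. -/
noncomputable def hConst (β₀ γ₀ : ℝ) : ℝ :=
  ∫ z, Phi (-|β₀ + γ₀ * z|) ∂(gaussianReal 0 1)

end Probit

/-!
The quantity `s*` is `n` times the smallest empirical error rate over half-spaces, so the bound is a
one-sided uniform law of large numbers for the sets `{(x, y) | y x̄ · u ≤ 0}`.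

* *Population level.* Given the covariates, the direction `u` errs on an observation with conditional
  probability `Φ(η)` or `1 - Φ(η) = Φ(-η)`, or `1` on the boundary `x̄ · u = 0`, where
  `η = β₀ + x · β`. In every case this is at least `Φ(-|η|)`, and `x · β ∼ N(0, γ₀²)`, so every `u`
  has error probability at least `h` (`IsProbitModel.hConst_le_measureReal_errorSet`).
* *Independence.* Conditional independence of the responses, together with the fact that the `i`-th
  conditional law depends on `x_i` only, makes the pairs `(x_i, y_i)` independent
  (`IsProbitModel.map_pair_eq_pi`).
* *Deviation.* Let `D` be the supremum over `u` of `∑ i (P(error) - 1(error at i))`. It changes by at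
  most `1` when one observation changes, so McDiarmid's inequality gives
  `P(D - E D ≥ n ε) ≤ exp(-2 ε² n)`. Symmetrization bounds `E D` by twice a Rademacher average.
  Recentring the indicators to the values `±1/2`, which costs nothing because the signs are applied
  to a difference, yields `E D ≤ √(2 n K)` by Massart's lemma whenever the number of error patterns
  on `n` points is at most `exp K` (`measureReal_exists_sum_indicator_lt_le`).
* *Counting.* Homogeneous closed half-spaces of `ℝ^m` shatter only linearly independent
  families, so the Sauer–Shelah lemma and `∑_{k ≤ m} C(n, k) ≤ (e n / m) ^ m` give
  `K = m log (e n / m)`, where `m = d + 1` (`ncard_halfspace_patterns_le`).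

The deviation inequality is applied to a countable dense set of directions, which keeps all suprema
measurable. Nothing is lost: if `u` does not err at an observation, neither do nearby directions, so
the infimum over the sphere is the infimum over a dense subset.
-/

open scoped NNReal

/-! ### McDiarmid's inequality -/

/-- Hoeffding's lemma for a function of oscillation at most `c`. -/
theorem hasSubgaussianMGF_sub_integral_of_diff_le {E : Type*} [MeasurableSpace E]
    (ν : Measure E) [IsProbabilityMeasure ν] {f : E → ℝ} (hf : Measurable f) {c : ℝ≥0}
    (hdiff : ∀ a b, f a - f b ≤ c) :
    HasSubgaussianMGF (fun a => f a - ∫ a, f a ∂ν) ((c / 2) ^ 2) ν := by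
  have hE : Nonempty E := nonempty_of_isProbabilityMeasure ν
  obtain ⟨a₀⟩ := hE
  have hbdd : BddBelow (Set.range f) := ⟨f a₀ - c, by
    rintro _ ⟨b, rfl⟩; linarith [hdiff a₀ b]⟩
  have hmem : ∀ a, f a ∈ Set.Icc (⨅ b, f b) ((⨅ b, f b) + c) := fun a => by
    have : Nonempty E := ⟨a₀⟩
    refine ⟨ciInf_le hbdd a, ?_⟩
    have : f a - c ≤ ⨅ b, f b := le_ciInf fun b => by linarith [hdiff a b]
    linarith
  have h := hasSubgaussianMGF_of_mem_Icc (μ := ν) hf.aemeasurable (ae_of_all _ hmem)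
  simpa using h

/-- A function of `n` independent variables that varies by at most `c` in each of them has the
moment generating function bound of `n` independent variables of range `c`. The induction integrates
out the first variable, which preserves the bounded differences of the rest. -/
theorem mgf_sub_integral_pi_le {E : Type*} [MeasurableSpace E] {c : ℝ≥0} {C : ℝ} (t : ℝ) :
    ∀ {n : ℕ} (ν : Fin n → Measure E) [∀ i, IsProbabilityMeasure (ν i)] {f : (Fin n → E) → ℝ}
    (_hf : Measurable f) (_hC : ∀ z, |f z| ≤ C)
    (_hdiff : ∀ z i a b, f (Function.update z i a) - f (Function.update z i b) ≤ c),
    ∫ z, Real.exp (t * (f z - ∫ z, f z ∂Measure.pi ν)) ∂Measure.pi ν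
      ≤ Real.exp (n * ((c : ℝ) / 2) ^ 2 * t ^ 2 / 2) := by
  intro n
  induction n with
  | zero =>
    intro ν _ f hf hC hdiff
    rw [Measure.pi_of_empty ν, integral_dirac' _ _ hf.stronglyMeasurable,
      integral_dirac' _ _ (((hf.sub_const _).const_mul t).exp.stronglyMeasurable)]
    simp
  | succ n ih =>
    intro ν _ f hf hC hdiff
    let e := MeasurableEquiv.piFinSuccAbove (fun _ : Fin (n + 1) => E) 0
    have he := measurePreserving_piFinSuccAbove ν 0
    let ν' : Fin n → Measure E := fun j => ν ((0 : Fin (n + 1)).succAbove j)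
    let F : E → (Fin n → E) → ℝ := fun a r => f (e.symm (a, r))
    have hFm : Measurable (fun p : E × (Fin n → E) => F p.1 p.2) := hf.comp e.symm.measurable
    have hFm1 : ∀ r, Measurable (fun a => F a r) := fun r => hFm.comp measurable_prodMk_right
    have hFC : ∀ a r, |F a r| ≤ C := fun a r => hC _
    -- Fubini, stated for every continuous `φ` because it serves both the mean and the exponential.
    have key : ∀ φ : ℝ → ℝ, Continuous φ → ∫ z, φ (f z) ∂Measure.pi ν
        = ∫ r, ∫ a, φ (F a r) ∂ν 0 ∂Measure.pi ν' := by
      intro φ hφ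
      have hint : Integrable (fun p : E × (Fin n → E) => φ (F p.1 p.2))
          ((ν 0).prod (Measure.pi ν')) := by
        obtain ⟨K, hK⟩ := (isCompact_Icc (a := -C) (b := C)).exists_bound_of_continuousOn
          hφ.continuousOn
        refine Integrable.of_bound (hφ.measurable.comp hFm).aestronglyMeasurable K
          (ae_of_all _ fun p => hK _ (abs_le.1 (hFC _ _)))
      rw [← integral_prod_symm _ hint, ← he.symm.integral_comp e.symm.measurableEmbedding]
    set g : (Fin n → E) → ℝ := fun r => ∫ a, F a r ∂ν 0 with hg
    have hgm : Measurable g := (hFm.stronglyMeasurable.integral_prod_left').measurable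
    have hgC : ∀ r, |g r| ≤ C := fun r => by
      have := norm_integral_le_of_norm_le_const (μ := ν 0) (f := fun a => F a r) (C := C)
        (ae_of_all _ fun a => hFC a r)
      simpa using this
    have hFint : ∀ r, Integrable (fun a => F a r) (ν 0) := fun r =>
      Integrable.of_bound (hFm1 r).aestronglyMeasurable C (ae_of_all _ fun a => hFC a r)
    have hF : ∀ a r, F a r = f (Fin.cons a r) := fun a r => by
      change f (Fin.insertNth 0 a r) = _
      rw [Fin.insertNth_zero']
    have hgdiff : ∀ r i a b, g (Function.update r i a) - g (Function.update r i b) ≤ c := by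
      intro r i a b
      rw [hg]
      simp only
      rw [← integral_sub (hFint _) (hFint _)]
      calc _ ≤ ∫ _, (c : ℝ) ∂ν 0 := by
            refine integral_mono ((hFint _).sub (hFint _)) (integrable_const _) fun x => ?_
            simp only [hF, Fin.cons_update]
            exact hdiff _ _ _ _
        _ = c := by simp
    have hm : ∫ z, f z ∂Measure.pi ν = ∫ r, g r ∂Measure.pi ν' := key id continuous_id
    rw [key (fun s => Real.exp (t * (s - ∫ z, f z ∂Measure.pi ν))) (by fun_prop), hm]
    have hinner : ∀ r, ∫ a, Real.exp (t * (F a r - ∫ r, g r ∂Measure.pi ν')) ∂ν 0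
        ≤ Real.exp (t * (g r - ∫ r, g r ∂Measure.pi ν')) *
          Real.exp (((c : ℝ) / 2) ^ 2 * t ^ 2 / 2) := by
      intro r
      have h1 := (hasSubgaussianMGF_sub_integral_of_diff_le (ν 0) (hFm1 r) (c := c)
        (fun a b => by
          have := hdiff (Fin.cons a r) 0 a b
          simpa [hF, Fin.update_cons_zero] using this)).mgf_le t
      rw [mgf] at h1
      have h2 : ∀ a, Real.exp (t * (F a r - ∫ r, g r ∂Measure.pi ν'))
          = Real.exp (t * (g r - ∫ r, g r ∂Measure.pi ν')) * Real.exp (t * (F a r - g r)) := by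
        intro a; rw [← Real.exp_add]; ring_nf
      simp_rw [h2]
      rw [integral_const_mul]
      gcongr
      simpa using h1
    have hEC : |∫ r, g r ∂Measure.pi ν'| ≤ C := by
      have := norm_integral_le_of_norm_le_const (μ := Measure.pi ν') (f := g) (C := C)
        (ae_of_all _ hgC)
      simpa using this
    have hexpint : Integrable (fun r => Real.exp (t * (g r - ∫ r, g r ∂Measure.pi ν')))
        (Measure.pi ν') := by
      refine Integrable.of_bound (by fun_prop) (Real.exp (|t| * (2 * C)))
        (ae_of_all _ fun r => ?_)
      rw [Real.norm_eq_abs, Real.abs_exp, Real.exp_le_exp]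
      refine (le_abs_self _).trans ?_
      rw [abs_mul]
      gcongr
      exact (abs_sub _ _).trans (by linarith [hgC r])
    calc _ ≤ ∫ r, Real.exp (t * (g r - ∫ r, g r ∂Measure.pi ν')) *
          Real.exp (((c : ℝ) / 2) ^ 2 * t ^ 2 / 2) ∂Measure.pi ν' :=
          integral_mono_of_nonneg (ae_of_all _ fun r => integral_nonneg fun a => (Real.exp_pos _).le)
            (hexpint.mul_const _) (ae_of_all _ hinner)
      _ ≤ Real.exp (n * ((c : ℝ) / 2) ^ 2 * t ^ 2 / 2) *
          Real.exp (((c : ℝ) / 2) ^ 2 * t ^ 2 / 2) := by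
          rw [integral_mul_const]
          gcongr
          exact ih ν' hgm hgC hgdiff
      _ = _ := by
          rw [← Real.exp_add]; push_cast; ring_nf

/-- **McDiarmid's bounded differences inequality**. -/
theorem measureReal_pi_sub_integral_ge_le {E : Type*} [MeasurableSpace E] {c : ℝ≥0} {C : ℝ}
    {n : ℕ} (ν : Fin n → Measure E) [∀ i, IsProbabilityMeasure (ν i)] {f : (Fin n → E) → ℝ}
    (hf : Measurable f) (hC : ∀ z, |f z| ≤ C)
    (hdiff : ∀ z i a b, f (Function.update z i a) - f (Function.update z i b) ≤ c)
    {ε : ℝ} (hε : 0 ≤ ε) :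
    (Measure.pi ν).real {z | ε ≤ f z - ∫ z, f z ∂Measure.pi ν}
      ≤ Real.exp (-ε ^ 2 / (2 * (n * ((c : ℝ) / 2) ^ 2))) := by
  have hEC : |∫ r, f r ∂Measure.pi ν| ≤ C := by
    have := norm_integral_le_of_norm_le_const (μ := Measure.pi ν) (f := f) (C := C)
      (ae_of_all _ hC)
    simpa using this
  have hsub : HasSubgaussianMGF (fun z => f z - ∫ z, f z ∂Measure.pi ν)
      (n * (c / 2) ^ 2) (Measure.pi ν) := by
    refine ⟨fun t => ?_, fun t => ?_⟩
    · refine Integrable.of_bound (by fun_prop) (Real.exp (|t| * (2 * C)))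
        (ae_of_all _ fun r => ?_)
      rw [Real.norm_eq_abs, Real.abs_exp, Real.exp_le_exp]
      refine (le_abs_self _).trans ?_
      rw [abs_mul]
      gcongr
      exact (abs_sub _ _).trans (by linarith [hC r])
    · have := mgf_sub_integral_pi_le t ν hf hC hdiff
      simpa [mgf] using this
  simpa using hsub.measure_ge_le hε

/-! ### Rademacher sums -/

/-- The sign encoded by a Boolean: `1` for `true` and `-1` for `false`. -/
def rademacherSign (b : Bool) : ℝ := if b then 1 else -1

/-- The exponential moment of a Rademacher sum with weights `±1/2`, written as a sum over all `2 ^ n`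
sign patterns. -/
theorem sum_exp_rademacher_le {n : ℕ} (v : Fin n → ℝ) (hv : ∀ i, |v i| = 1 / 2) (t : ℝ) :
    ∑ σ : Fin n → Bool, Real.exp (t * ∑ i, rademacherSign (σ i) * v i)
      ≤ 2 ^ n * Real.exp (n * t ^ 2 / 8) := by
  have h1 : ∀ σ : Fin n → Bool, Real.exp (t * ∑ i, rademacherSign (σ i) * v i)
      = ∏ i, Real.exp (t * (rademacherSign (σ i) * v i)) := fun σ => by
    rw [Finset.mul_sum, Real.exp_sum]
  simp_rw [h1]
  rw [← Fintype.prod_sum (fun (i : Fin n) (b : Bool) => Real.exp (t * (rademacherSign b * v i)))]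
  have h2 : ∀ i, ∑ b, Real.exp (t * (rademacherSign b * v i)) ≤ 2 * Real.exp (t ^ 2 / 8) := by
    intro i
    have hc := Real.cosh_le_exp_half_sq (t * v i)
    have : (t * v i) ^ 2 / 2 = t ^ 2 / 8 := by
      rw [mul_pow, ← sq_abs (v i), hv]; ring
    rw [this, Real.cosh_eq] at hc
    simp only [Fintype.sum_bool, rademacherSign]
    simp only [if_true, one_mul, Bool.false_eq_true, if_false, neg_one_mul, mul_neg]
    linarith
  calc _ ≤ ∏ _i : Fin n, (2 * Real.exp (t ^ 2 / 8)) :=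
        Finset.prod_le_prod (fun i _ => Finset.sum_nonneg fun b _ => (Real.exp_pos _).le)
          fun i _ => h2 i
    _ = _ := by
      rw [Finset.prod_const, Finset.card_univ, Fintype.card_fin, mul_pow, ← Real.exp_nat_mul]
      ring_nf

/-- **Massart's finite class lemma** for a family of at most `exp K` vectors with entries `±1/2`, with
the average over signs written as a sum over all `2 ^ n` sign patterns. -/
theorem sum_iSup_rademacher_le {n : ℕ} (hn : 0 < n) {U : Type*} [Nonempty U]
    (v : U → Fin n → ℝ) (hv : ∀ u i, |v u i| = 1 / 2) {T : Finset (Fin n → ℝ)}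
    (hT : ∀ u, v u ∈ T) {K : ℝ} (hK : 0 < K) (hTK : (T.card : ℝ) ≤ Real.exp K) :
    ∑ σ : Fin n → Bool, ⨆ u, ∑ i, rademacherSign (σ i) * v u i
      ≤ 2 ^ n * Real.sqrt (n * K / 2) := by
  classical
  -- Discarding the members of `T` with other entries makes the moment bound available on all of it.
  set T' := T.filter (fun w => ∀ i, |w i| = 1 / 2) with hT'
  have hT'c : (T'.card : ℝ) ≤ Real.exp K :=
    le_trans (by exact_mod_cast Finset.card_le_card (Finset.filter_subset _ _)) hTK
  have hvT' : ∀ u, v u ∈ T' := fun u => Finset.mem_filter.2 ⟨hT u, hv u⟩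
  set M : (Fin n → Bool) → ℝ := fun σ => ⨆ u, ∑ i, rademacherSign (σ i) * v u i with hM
  have hnR : (0 : ℝ) < n := by exact_mod_cast hn
  -- This `t` minimizes the final bound `K / t + n t / 8`.
  set t : ℝ := Real.sqrt (8 * K / n) with ht
  have ht0 : 0 < t := Real.sqrt_pos.2 (by positivity)
  have hpos : ∀ σ : Fin n → Bool, 0 < ∑ w ∈ T', Real.exp (t * ∑ i, rademacherSign (σ i) * w i) := by
    intro σ
    obtain ⟨u⟩ := ‹Nonempty U›
    exact Finset.sum_pos (fun w _ => Real.exp_pos _) ⟨_, hvT' u⟩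
  have hexp : ∀ σ, Real.exp (t * M σ)
      ≤ ∑ w ∈ T', Real.exp (t * ∑ i, rademacherSign (σ i) * w i) := by
    intro σ
    rw [← Real.le_log_iff_exp_le (hpos σ), ← le_div_iff₀' ht0]
    refine ciSup_le fun u => ?_
    rw [le_div_iff₀' ht0, Real.le_log_iff_exp_le (hpos σ)]
    exact Finset.single_le_sum (f := fun w => Real.exp (t * ∑ i, rademacherSign (σ i) * w i))
      (fun w _ => (Real.exp_pos _).le) (hvT' u)
  have hjensen : Real.exp (∑ σ : Fin n → Bool, ((2 : ℝ) ^ n)⁻¹ * (t * M σ))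
      ≤ ∑ σ : Fin n → Bool, ((2 : ℝ) ^ n)⁻¹ * Real.exp (t * M σ) := by
    have := convexOn_exp.map_sum_le (t := (Finset.univ : Finset (Fin n → Bool)))
      (w := fun _ => ((2 : ℝ) ^ n)⁻¹) (p := fun σ => t * M σ) (fun _ _ => by positivity)
      (by simp) (fun _ _ => Set.mem_univ _)
    simpa using this
  have hbound : Real.exp (∑ σ : Fin n → Bool, ((2 : ℝ) ^ n)⁻¹ * (t * M σ))
      ≤ Real.exp (K + n * t ^ 2 / 8) := by
    refine hjensen.trans ?_
    rw [← Finset.mul_sum]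
    calc _ ≤ ((2 : ℝ) ^ n)⁻¹ * ∑ σ : Fin n → Bool,
            ∑ w ∈ T', Real.exp (t * ∑ i, rademacherSign (σ i) * w i) := by
          gcongr with σ; exact hexp σ
      _ = ((2 : ℝ) ^ n)⁻¹ * ∑ w ∈ T', ∑ σ : Fin n → Bool,
            Real.exp (t * ∑ i, rademacherSign (σ i) * w i) := by rw [Finset.sum_comm]
      _ ≤ ((2 : ℝ) ^ n)⁻¹ * ∑ w ∈ T', (2 ^ n * Real.exp (n * t ^ 2 / 8)) := by
          gcongr with w hw
          exact sum_exp_rademacher_le w (Finset.mem_filter.1 hw).2 t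
      _ = T'.card * Real.exp (n * t ^ 2 / 8) := by
          rw [Finset.sum_const, nsmul_eq_mul]; field_simp
      _ ≤ Real.exp K * Real.exp (n * t ^ 2 / 8) := by gcongr
      _ = _ := by rw [Real.exp_add]
  rw [Real.exp_le_exp, ← Finset.mul_sum, ← Finset.mul_sum,
    inv_mul_le_iff₀ (by positivity)] at hbound
  have htsq : t ^ 2 = 8 * K / n := Real.sq_sqrt (by positivity)
  have h2K : K + n * t ^ 2 / 8 = t * Real.sqrt (n * K / 2) := by
    rw [htsq, ht, ← Real.sqrt_mul (by positivity),
      show 8 * K / n * (n * K / 2) = (2 * K) ^ 2 by field_simp; ring, Real.sqrt_sq (by positivity)]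
    field_simp; ring
  rw [h2K] at hbound
  have : t * ∑ σ, M σ ≤ t * (2 ^ n * Real.sqrt (n * K / 2)) := by linarith
  exact le_of_mul_le_mul_left this ht0

/-! ### Suprema of bounded families -/

theorem bddAbove_range_of_abs_le {U : Type*} {h : U → ℝ} {C : ℝ} (hC : ∀ u, |h u| ≤ C) :
    BddAbove (Set.range h) :=
  ⟨C, by rintro _ ⟨u, rfl⟩; exact (abs_le.1 (hC u)).2⟩

theorem abs_iSup_le_of_abs_le {U : Type*} [Nonempty U] {h : U → ℝ} {C : ℝ} (hC : ∀ u, |h u| ≤ C) :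
    |⨆ u, h u| ≤ C := by
  obtain ⟨u⟩ := ‹Nonempty U›
  have : Nonempty U := ⟨u⟩
  exact abs_le.2 ⟨(abs_le.1 (hC u)).1.trans (le_ciSup (bddAbove_range_of_abs_le hC) u),
    ciSup_le fun u => (abs_le.1 (hC u)).2⟩

theorem integrable_iSup_of_abs_le {X U : Type*} [MeasurableSpace X] [Countable U] [Nonempty U]
    {μ : Measure X} [IsFiniteMeasure μ] {h : U → X → ℝ} (hm : ∀ u, Measurable (h u)) {C : ℝ}
    (hC : ∀ u x, |h u x| ≤ C) : Integrable (fun x => ⨆ u, h u x) μ :=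
  Integrable.of_bound (Measurable.iSup hm).aestronglyMeasurable C
    (ae_of_all _ fun x => abs_iSup_le_of_abs_le fun u => hC u x)

theorem abs_sum_le_card_mul {n : ℕ} {v : Fin n → ℝ} {B : ℝ} (hv : ∀ i, |v i| ≤ B) :
    |∑ i, v i| ≤ n * B :=
  (Finset.abs_sum_le_sum_abs _ _).trans <| (Finset.sum_le_sum fun i _ => hv i).trans (by simp)

/-! ### Symmetrization -/

/-- Exchanging the `i`-th entries of two independent samples for those `i` with `σ i = false` does
not change their joint law. -/
theorem measurePreserving_swapCoord {E : Type*} [MeasurableSpace E] {n : ℕ}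
    (ν : Fin n → Measure E) [∀ i, IsProbabilityMeasure (ν i)] (σ : Fin n → Bool) :
    MeasurePreserving (fun p : (Fin n → E) × (Fin n → E) =>
        ((fun i => if σ i then p.1 i else p.2 i, fun i => if σ i then p.2 i else p.1 i) :
          (Fin n → E) × (Fin n → E)))
      ((Measure.pi ν).prod (Measure.pi ν)) ((Measure.pi ν).prod (Measure.pi ν)) := by
  have h := measurePreserving_arrowProdEquivProdArrow E E (Fin n) ν ν
  have hs : MeasurePreserving
      (fun (w : Fin n → E × E) i => (if σ i then id else Prod.swap : E × E → E × E) (w i))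
      (Measure.pi fun i => (ν i).prod (ν i)) (Measure.pi fun i => (ν i).prod (ν i)) := by
    refine measurePreserving_pi _ _ fun i => ?_
    cases σ i
    · simpa using Measure.measurePreserving_swap
    · simpa using MeasurePreserving.id _
  convert h.comp (hs.comp h.symm) using 1
  funext p
  refine Prod.ext (funext fun i => ?_) (funext fun i => ?_) <;>
    cases hi : σ i <;>
    simp [hi, MeasurableEquiv.arrowProdEquivProdArrow, Equiv.arrowProdEquivProdArrow]

section Symmetrization

variable {E U : Type*} [MeasurableSpace E] [Countable U] [Nonempty U] {n : ℕ}
  (ν : Fin n → Measure E) [∀ i, IsProbabilityMeasure (ν i)] {g : U → E → ℝ} {B : ℝ}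

/-- The expected value under `ν i` is replaced by the value on an independent copy of the sample. -/
theorem integral_iSup_sub_le_integral_prod (hg : ∀ u, Measurable (g u)) (hB : ∀ u a, |g u a| ≤ B) :
    ∫ z, ⨆ u, ∑ i, (∫ a, g u a ∂ν i - g u (z i)) ∂Measure.pi ν
      ≤ ∫ p : (Fin n → E) × (Fin n → E), ⨆ u, ∑ i, (g u (p.2 i) - g u (p.1 i))
          ∂(Measure.pi ν).prod (Measure.pi ν) := by
  have hgi : ∀ u i, Integrable (g u) (ν i) := fun u i =>
    Integrable.of_bound (hg u).aestronglyMeasurable B (ae_of_all _ (hB u))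
  have hintB : ∀ u i, |∫ a, g u a ∂ν i| ≤ B := fun u i => by
    simpa using norm_integral_le_of_norm_le_const (μ := ν i) (f := g u) (C := B)
      (ae_of_all _ (hB u))
  have hint1 : Integrable (fun z : Fin n → E => ⨆ u, ∑ i, (∫ a, g u a ∂ν i - g u (z i)))
      (Measure.pi ν) :=
    integrable_iSup_of_abs_le (fun u => by have := hg u; fun_prop) (C := n * (B + B))
      fun u z => abs_sum_le_card_mul fun i =>
        (abs_sub _ _).trans (add_le_add (hintB u i) (hB u _))
  have hb2 : ∀ u (p : (Fin n → E) × (Fin n → E)),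
      |∑ i, (g u (p.2 i) - g u (p.1 i))| ≤ n * (B + B) := fun u p =>
    abs_sum_le_card_mul fun i => (abs_sub _ _).trans (add_le_add (hB u _) (hB u _))
  have hint2 : Integrable (fun p : (Fin n → E) × (Fin n → E) =>
      ⨆ u, ∑ i, (g u (p.2 i) - g u (p.1 i))) ((Measure.pi ν).prod (Measure.pi ν)) :=
    integrable_iSup_of_abs_le (fun u => by have := hg u; fun_prop) hb2
  rw [integral_prod _ hint2]
  refine integral_mono hint1 hint2.integral_prod_left fun z => ciSup_le fun u => ?_
  have hint3 : ∀ i, Integrable (fun z' : Fin n → E => g u (z' i)) (Measure.pi ν) := fun i =>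
    integrable_comp_eval (hgi u i)
  have hint4 : ∀ i, Integrable (fun z' : Fin n → E => g u (z' i) - g u (z i)) (Measure.pi ν) :=
    fun i => (hint3 i).sub (integrable_const _)
  calc ∑ i, (∫ a, g u a ∂ν i - g u (z i))
      = ∫ z' : Fin n → E, ∑ i, (g u (z' i) - g u (z i)) ∂Measure.pi ν := by
        rw [integral_finsetSum _ fun i _ => hint4 i]
        refine Finset.sum_congr rfl fun i _ => ?_
        rw [integral_sub (hint3 i) (integrable_const _)]
        have hev := integral_comp_eval (μ := ν) (i := i) (f := g u) (hg u).aestronglyMeasurable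
        simp [hev]
    _ ≤ ∫ z', ⨆ u, ∑ i, (g u (z' i) - g u (z i)) ∂Measure.pi ν := by
        refine integral_mono (integrable_finsetSum _ fun i _ => hint4 i)
          (integrable_iSup_of_abs_le (fun u => by have := hg u; fun_prop)
            fun u z' => hb2 u (z, z')) fun z' => ?_
        exact le_ciSup (bddAbove_range_of_abs_le fun u => hb2 u (z, z')) u

theorem abs_rademacherSign (b : Bool) : |rademacherSign b| = 1 := by
  cases b <;> simp [rademacherSign]

/-- For a fixed sign pattern `σ`, exchanging the two samples where `σ` is negative multiplies the
differences by the signs; subadditivity of the supremum then separates the samples. -/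
theorem integral_iSup_sub_le_of_sign (hg : ∀ u, Measurable (g u)) (hB : ∀ u a, |g u a| ≤ B)
    (σ : Fin n → Bool) :
    ∫ z, ⨆ u, ∑ i, (∫ a, g u a ∂ν i - g u (z i)) ∂Measure.pi ν
      ≤ ∫ z, ⨆ u, ∑ i, rademacherSign (σ i) * g u (z i) ∂Measure.pi ν
        + ∫ z, ⨆ u, ∑ i, rademacherSign (!σ i) * g u (z i) ∂Measure.pi ν := by
  refine (integral_iSup_sub_le_integral_prod ν hg hB).trans ?_
  have hswap := measurePreserving_swapCoord ν σ
  have hb2 : ∀ u (p : (Fin n → E) × (Fin n → E)),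
      |∑ i, (g u (p.2 i) - g u (p.1 i))| ≤ n * (B + B) := fun u p =>
    abs_sum_le_card_mul fun i => (abs_sub _ _).trans (add_le_add (hB u _) (hB u _))
  have hm2 : ∀ u, Measurable fun p : (Fin n → E) × (Fin n → E) =>
    ∑ i, (g u (p.2 i) - g u (p.1 i)) := fun u => by have := hg u; fun_prop
  have hbσ : ∀ (τ : Fin n → Bool) u (z : Fin n → E),
      |∑ i, rademacherSign (τ i) * g u (z i)| ≤ n * B := fun τ u z =>
    abs_sum_le_card_mul fun i => by rw [abs_mul, abs_rademacherSign, one_mul]; exact hB u _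
  have hintσ : ∀ τ : Fin n → Bool, Integrable
      (fun z : Fin n → E => ⨆ u, ∑ i, rademacherSign (τ i) * g u (z i)) (Measure.pi ν) := fun τ =>
    integrable_iSup_of_abs_le (fun u => by have := hg u; fun_prop) (hbσ τ)
  have hfst := (hintσ fun i => !σ i).comp_fst (Measure.pi ν)
  have hsnd := (hintσ σ).comp_snd (Measure.pi ν)
  rw [← hswap.map_eq, integral_map hswap.measurable.aemeasurable
    (Measurable.iSup hm2).aestronglyMeasurable]
  have hsum : ∫ z, (⨆ u, ∑ i, rademacherSign (σ i) * g u (z i)) ∂Measure.pi ν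
      + ∫ z, (⨆ u, ∑ i, rademacherSign (!σ i) * g u (z i)) ∂Measure.pi ν
      = ∫ p : (Fin n → E) × (Fin n → E), ((⨆ u, ∑ i, rademacherSign (σ i) * g u (p.2 i))
        + ⨆ u, ∑ i, rademacherSign (!σ i) * g u (p.1 i)) ∂(Measure.pi ν).prod (Measure.pi ν) := by
    rw [integral_add hsnd hfst, integral_fun_snd
      (f := fun z : Fin n → E => ⨆ u, ∑ i, rademacherSign (σ i) * g u (z i)), integral_fun_fst
      (f := fun z : Fin n → E => ⨆ u, ∑ i, rademacherSign (!σ i) * g u (z i))]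
    simp
  rw [hsum]
  refine integral_mono (hswap.integrable_comp_of_integrable (integrable_iSup_of_abs_le hm2 hb2))
    (hsnd.add hfst) fun p => ?_
  refine ciSup_le fun u => ?_
  have : ∑ i, (g u (if σ i then p.2 i else p.1 i) - g u (if σ i then p.1 i else p.2 i))
      = ∑ i, rademacherSign (σ i) * g u (p.2 i) + ∑ i, rademacherSign (!σ i) * g u (p.1 i) := by
    rw [← Finset.sum_add_distrib]
    refine Finset.sum_congr rfl fun i _ => ?_
    cases σ i <;> (simp [rademacherSign]; ring)
  refine this.le.trans (add_le_add ?_ ?_)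
  · exact le_ciSup (bddAbove_range_of_abs_le fun u => hbσ σ u p.2) u
  · exact le_ciSup (bddAbove_range_of_abs_le fun u => hbσ (fun i => !σ i) u p.1) u

/-- **Symmetrization**: the expected one-sided uniform deviation is at most twice the Rademacher
average of the class. Both sides carry the factor `2 ^ n` of the average over sign patterns. -/
theorem integral_iSup_sub_le_integral_rademacher (hg : ∀ u, Measurable (g u))
    (hB : ∀ u a, |g u a| ≤ B) :
    2 ^ n * ∫ z, ⨆ u, ∑ i, (∫ a, g u a ∂ν i - g u (z i)) ∂Measure.pi ν
      ≤ 2 * ∫ z, ∑ σ : Fin n → Bool, ⨆ u, ∑ i, rademacherSign (σ i) * g u (z i)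
          ∂Measure.pi ν := by
  have hbσ : ∀ (τ : Fin n → Bool) u (z : Fin n → E),
      |∑ i, rademacherSign (τ i) * g u (z i)| ≤ n * B := fun τ u z =>
    abs_sum_le_card_mul fun i => by rw [abs_mul, abs_rademacherSign, one_mul]; exact hB u _
  have hintσ : ∀ τ : Fin n → Bool, Integrable
      (fun z : Fin n → E => ⨆ u, ∑ i, rademacherSign (τ i) * g u (z i)) (Measure.pi ν) := fun τ =>
    integrable_iSup_of_abs_le (fun u => by have := hg u; fun_prop) (hbσ τ)
  rw [integral_finsetSum _ fun σ _ => hintσ σ]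
  have hflip : ∑ σ : Fin n → Bool, ∫ z, (⨆ u, ∑ i, rademacherSign (!σ i) * g u (z i))
        ∂Measure.pi ν
      = ∑ σ : Fin n → Bool, ∫ z, (⨆ u, ∑ i, rademacherSign (σ i) * g u (z i)) ∂Measure.pi ν :=
    Equiv.sum_comp (Equiv.piCongrRight fun _ : Fin n => Equiv.boolNot)
      (fun σ => ∫ z, (⨆ u, ∑ i, rademacherSign (σ i) * g u (z i)) ∂Measure.pi ν)
  have h := Finset.sum_le_sum fun (σ : Fin n → Bool) (_ : σ ∈ Finset.univ) =>
    integral_iSup_sub_le_of_sign ν hg hB σ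
  rw [Finset.sum_add_distrib, hflip] at h
  simp only [Finset.sum_const, Finset.card_univ, Fintype.card_fun, Fintype.card_bool,
    Fintype.card_fin, nsmul_eq_mul] at h
  push_cast at h
  linarith

end Symmetrization

/-! ### Uniform deviations over a class of sets -/

section Deviation

variable {E U : Type*} [MeasurableSpace E] [Countable U] [Nonempty U] {n : ℕ}
  (ν : Fin n → Measure E) [∀ i, IsProbabilityMeasure (ν i)] {A : U → Set E} {K : ℝ}

/-- Expected one-sided uniform deviation of a class of sets that picks out at most `exp K` subsets
of any `n` points. -/
theorem integral_iSup_measureReal_sub_indicator_le (hn : 0 < n) (hA : ∀ u, MeasurableSet (A u))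
    (hK : 0 < K)
    (hcard : ∀ z : Fin n → E, ((Set.range fun u => {i | z i ∈ A u}).ncard : ℝ) ≤ Real.exp K) :
    ∫ z, ⨆ u, ∑ i, ((ν i).real (A u) - (A u).indicator (fun _ => (1 : ℝ)) (z i)) ∂Measure.pi ν
      ≤ Real.sqrt (2 * n * K) := by
  classical
  -- Recentred indicators take the values `±1/2`; this halves the constant in Massart's lemma.
  set g : U → E → ℝ := fun u a => (A u).indicator (fun _ => (1 : ℝ)) a - 1 / 2 with hg
  have hgabs : ∀ u a, |g u a| = 1 / 2 := fun u a => by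
    by_cases ha : a ∈ A u
    · norm_num [hg, ha]
    · norm_num [hg, ha]
  have hgm : ∀ u, Measurable (g u) := fun u =>
    (measurable_const.indicator (hA u)).sub_const _
  have h := integral_iSup_sub_le_integral_rademacher ν hgm fun u a => (hgabs u a).le
  have hEg : ∀ u i a, ∫ a, g u a ∂ν i - g u a
      = (ν i).real (A u) - (A u).indicator (fun _ => (1 : ℝ)) a := by
    intro u i a
    simp only [hg]
    rw [integral_sub ((integrable_const _).indicator (hA u)) (integrable_const _),
      integral_indicator_const _ (hA u)]
    simp
  simp_rw [hEg] at h
  have hmassart : ∀ z : Fin n → E,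
      ∑ σ : Fin n → Bool, ⨆ u, ∑ i, rademacherSign (σ i) * g u (z i)
        ≤ 2 ^ n * Real.sqrt (n * K / 2) := by
    intro z
    let P : Finset (Set (Fin n)) := (Set.toFinite (Set.range fun u => {i | z i ∈ A u})).toFinset
    let T : Finset (Fin n → ℝ) :=
      P.image fun S i => S.indicator (fun _ => (1 : ℝ)) i - 1 / 2
    refine sum_iSup_rademacher_le hn (fun u i => g u (z i)) (fun u i => hgabs u _) (T := T)
      (fun u => ?_) hK ?_
    · refine Finset.mem_image.2 ⟨{i | z i ∈ A u}, by simp [P], ?_⟩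
      funext i
      simp [hg, Set.indicator_apply]
    · refine le_trans ?_ (hcard z)
      rw [Set.ncard_eq_toFinset_card _ (Set.toFinite _)]
      exact_mod_cast Finset.card_image_le
  have h2 : ∫ z, ∑ σ : Fin n → Bool, ⨆ u, ∑ i, rademacherSign (σ i) * g u (z i) ∂Measure.pi ν
      ≤ 2 ^ n * Real.sqrt (n * K / 2) := by
    calc _ ≤ ∫ _z : Fin n → E, 2 ^ n * Real.sqrt (n * K / 2) ∂Measure.pi ν := by
          refine integral_mono (integrable_finsetSum _ fun σ _ => integrable_iSup_of_abs_le
            (fun u => by have := hgm u; fun_prop) (C := n * (1 / 2)) fun u z =>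
              abs_sum_le_card_mul fun i => ?_) (integrable_const _) hmassart
          rw [abs_mul, abs_rademacherSign, one_mul, hgabs]
      _ = _ := by simp
  have hsqrt : Real.sqrt (2 * n * K) = 2 * Real.sqrt (n * K / 2) := by
    rw [show (2 * n * K : ℝ) = 2 ^ 2 * (n * K / 2) by ring, Real.sqrt_mul (by positivity),
      Real.sqrt_sq (by norm_num)]
  rw [hsqrt]
  have h2n : (0 : ℝ) < 2 ^ n := by positivity
  refine le_of_mul_le_mul_left ?_ h2n
  linarith

/-- **One-sided Vapnik–Chervonenkis inequality**: except with probability `exp (-2 ε² n)`, all sets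
of the class have empirical count at least their expected count minus `n ε + √(2 n K)`. -/
theorem measureReal_exists_sum_indicator_lt_le (hn : 0 < n) (hA : ∀ u, MeasurableSet (A u))
    (hK : 0 < K)
    (hcard : ∀ z : Fin n → E, ((Set.range fun u => {i | z i ∈ A u}).ncard : ℝ) ≤ Real.exp K)
    {ε : ℝ} (hε : 0 ≤ ε) :
    (Measure.pi ν).real {z | ∃ u, ∑ i, (A u).indicator (fun _ => (1 : ℝ)) (z i)
        < ∑ i, (ν i).real (A u) - n * ε - Real.sqrt (2 * n * K)}
      ≤ Real.exp (-2 * ε ^ 2 * n) := by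
  set D : (Fin n → E) → ℝ := fun z =>
    ⨆ u, ∑ i, ((ν i).real (A u) - (A u).indicator (fun _ => (1 : ℝ)) (z i)) with hD
  have hterm : ∀ u i a, |(ν i).real (A u) - (A u).indicator (fun _ => (1 : ℝ)) a| ≤ 1 := by
    intro u i a
    have h1 : (ν i).real (A u) ≤ 1 := measureReal_le_one
    have h0 : 0 ≤ (ν i).real (A u) := measureReal_nonneg
    by_cases ha : a ∈ A u <;> simp only [ha, Set.indicator_of_mem, Set.indicator_of_notMem,
      not_false_eq_true] <;> rw [abs_le] <;> constructor <;> linarith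
  have hb : ∀ u (z : Fin n → E),
      |∑ i, ((ν i).real (A u) - (A u).indicator (fun _ => (1 : ℝ)) (z i))| ≤ n * 1 :=
    fun u z => abs_sum_le_card_mul fun i => hterm u i _
  have hDm : Measurable D := Measurable.iSup fun u => Finset.measurable_sum _ fun i _ =>
    ((measurable_const.indicator (hA u)).comp (measurable_pi_apply i)).const_sub _
  have hDdiff : ∀ z i a b, D (Function.update z i a) - D (Function.update z i b) ≤ (1 : ℝ≥0) := by
    intro z i a b
    rw [sub_le_iff_le_add']
    refine ciSup_le fun u => ?_
    have hle := le_ciSup (bddAbove_range_of_abs_le fun u => hb u (Function.update z i b)) u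
    have hdiff : ∑ j, ((ν j).real (A u)
          - (A u).indicator (fun _ => (1 : ℝ)) (Function.update z i a j))
        - ∑ j, ((ν j).real (A u)
          - (A u).indicator (fun _ => (1 : ℝ)) (Function.update z i b j))
        = (A u).indicator (fun _ => (1 : ℝ)) b - (A u).indicator (fun _ => (1 : ℝ)) a := by
      rw [← Finset.sum_sub_distrib, Finset.sum_eq_single i]
      · simp
      · intro j _ hj; simp [hj]
      · simp
    have h1 : (A u).indicator (fun _ => (1 : ℝ)) b ≤ 1 :=
      Set.indicator_le_self' (fun _ _ => zero_le_one) b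
    have h0 : 0 ≤ (A u).indicator (fun _ => (1 : ℝ)) a :=
      Set.indicator_nonneg (fun _ _ => zero_le_one) a
    simp only [NNReal.coe_one]
    linarith
  have hmcd := measureReal_pi_sub_integral_ge_le (C := n * 1) ν hDm
    (fun z => abs_iSup_le_of_abs_le fun u => hb u z) hDdiff
    (mul_nonneg (Nat.cast_nonneg n) hε)
  have hnR : (0 : ℝ) < n := by exact_mod_cast hn
  have hexp : -((n : ℝ) * ε) ^ 2 / (2 * (n * (((1 : ℝ≥0) : ℝ) / 2) ^ 2)) = -2 * ε ^ 2 * n := by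
    simp only [NNReal.coe_one]; field_simp
  rw [hexp] at hmcd
  refine (measureReal_mono ?_).trans hmcd
  rintro z ⟨u, hu⟩
  have hle := le_ciSup (bddAbove_range_of_abs_le fun u => hb u z) u
  have hE := integral_iSup_measureReal_sub_indicator_le ν hn hA hK hcard
  rw [Finset.sum_sub_distrib] at hle
  change (n : ℝ) * ε ≤ D z - ∫ z, D z ∂Measure.pi ν
  have hDz : D z = ⨆ u, ∑ i, ((ν i).real (A u) - (A u).indicator (fun _ => (1 : ℝ)) (z i)) := rfl
  rw [← hDz] at hle
  linarith

end Deviation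

/-! ### Counting half-spaces -/

/-- A family of points shattered by homogeneous closed half-spaces is linearly independent. In a
nontrivial relation `∑ c_j z_j = 0`, a half-space `{z | z · u ≤ 0}` that contains exactly the `z_j`
with `c_j ≥ 0` would make `∑ c_j (z_j · u)` negative. -/
theorem linearIndepOn_of_shatters_halfspaces {V : Type*} [NormedAddCommGroup V] [InnerProductSpace ℝ V]
    {ι : Type*} [DecidableEq ι] (z : ι → V) {F : Finset (Finset ι)}
    (hF : ∀ t ∈ F, ∃ u : V, ∀ i, i ∈ t ↔ inner ℝ (z i) u ≤ 0) {s : Finset ι}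
    (hs : F.Shatters s) : LinearIndepOn ℝ z (s : Set ι) := by
  rw [linearIndepOn_finset_iff]
  by_contra! hcon
  obtain ⟨c, hc, i, hi, hci⟩ := hcon
  -- Flipping the sign of the relation if necessary, some coefficient is negative.
  obtain ⟨c, hc, i, hi, hci⟩ : ∃ c : ι → ℝ, ∑ j ∈ s, c j • z j = 0 ∧ ∃ i ∈ s, c i < 0 := by
    rcases lt_or_gt_of_ne hci with h | h
    · exact ⟨c, hc, i, hi, h⟩
    · exact ⟨fun j => -c j, by simp [hc], i, hi, by simpa using h⟩
  obtain ⟨t, ht, hst⟩ := hs (Finset.filter_subset (fun j => 0 ≤ c j) s)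
  obtain ⟨u, hu⟩ := hF t ht
  have hmem : ∀ j ∈ s, (inner ℝ (z j) u ≤ 0 ↔ 0 ≤ c j) := by
    intro j hj
    rw [← hu j]
    have := Finset.ext_iff.1 hst j
    simpa [hj] using this
  have hsum : ∑ j ∈ s, c j * inner ℝ (z j) u = 0 := by
    have := congrArg (fun v => inner ℝ v u) hc
    simpa [sum_inner, inner_smul_left] using this
  have hneg : ∑ j ∈ s, c j * inner ℝ (z j) u < 0 := by
    refine Finset.sum_neg' (fun j hj => ?_) ⟨i, hi, ?_⟩
    · rcases le_or_gt 0 (c j) with h | h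
      · exact mul_nonpos_of_nonneg_of_nonpos h ((hmem j hj).2 h)
      · have : ¬ inner ℝ (z j) u ≤ 0 := fun h' => absurd ((hmem j hj).1 h') (not_le.2 h)
        exact mul_nonpos_of_nonpos_of_nonneg h.le (not_le.1 this).le
    · have : ¬ inner ℝ (z i) u ≤ 0 := fun h' => absurd ((hmem i hi).1 h') (not_le.2 hci)
      exact mul_neg_of_neg_of_pos hci (not_le.1 this)
  exact hneg.ne hsum

/-- The partial binomial sum is at most `(e n / D) ^ D`, written as an exponential. -/
theorem sum_choose_le_exp {n D : ℕ} (hD : 0 < D) (hDn : D ≤ n) :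
    (∑ k ∈ Finset.Iic D, (n.choose k : ℝ)) ≤ Real.exp (D * Real.log (Real.exp 1 * n / D)) := by
  have hDR : (0 : ℝ) < D := by exact_mod_cast hD
  have hnR : (0 : ℝ) < n := by exact_mod_cast hD.trans_le hDn
  set x : ℝ := D / n with hx
  have hx0 : 0 < x := by positivity
  have hx1 : x ≤ 1 := by rw [hx, div_le_one hnR]; exact_mod_cast hDn
  -- Weighting by `x ^ D ≤ x ^ k` turns the sum into part of the expansion of `(1 + x) ^ n`.
  have h1 : x ^ D * ∑ k ∈ Finset.Iic D, (n.choose k : ℝ) ≤ Real.exp D := by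
    calc _ = ∑ k ∈ Finset.Iic D, x ^ D * (n.choose k : ℝ) := by rw [Finset.mul_sum]
      _ ≤ ∑ k ∈ Finset.Iic D, x ^ k * (n.choose k : ℝ) := by
          refine Finset.sum_le_sum fun k hk => ?_
          have := pow_le_pow_of_le_one hx0.le hx1 (Finset.mem_Iic.1 hk)
          gcongr
      _ ≤ ∑ k ∈ Finset.range (n + 1), x ^ k * (n.choose k : ℝ) := by
          refine Finset.sum_le_sum_of_subset_of_nonneg (fun k hk => ?_) fun k _ _ => by positivity
          have := Finset.mem_Iic.1 hk
          exact Finset.mem_range.2 (by omega)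
      _ = (x + 1) ^ n := by rw [add_pow]; simp
      _ ≤ Real.exp x ^ n := by gcongr; exact Real.add_one_le_exp x
      _ = Real.exp D := by rw [← Real.exp_nat_mul, hx]; congr 1; field_simp
  have h2 : Real.exp (D * Real.log (Real.exp 1 * n / D)) = Real.exp D / x ^ D := by
    rw [Real.exp_nat_mul, Real.exp_log (by positivity),
      show Real.exp 1 * n / D = Real.exp 1 / x by rw [hx]; field_simp, div_pow,
      ← Real.exp_nat_mul, mul_one]
  rw [h2, le_div_iff₀' (by positivity)]
  exact h1

/-- The number of subsets that homogeneous closed half-spaces cut out of `n` points of a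
`D`-dimensional space is at most `(e n / D) ^ D`. -/
theorem ncard_halfspace_patterns_le {V : Type*} [NormedAddCommGroup V] [InnerProductSpace ℝ V]
    [FiniteDimensional ℝ V] {n : ℕ} (hV : 0 < Module.finrank ℝ V) (hVn : Module.finrank ℝ V ≤ n)
    {U : Type*} (w : U → V) (z : Fin n → V) :
    ((Set.range fun u => {i | z i ∈ {a | inner ℝ a (w u) ≤ 0}}).ncard : ℝ)
      ≤ Real.exp (Module.finrank ℝ V * Real.log (Real.exp 1 * n / Module.finrank ℝ V)) := by
  classical
  let F : Finset (Finset (Fin n)) :=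
    Finset.univ.filter fun t => ∃ u, ∀ i, i ∈ t ↔ inner ℝ (z i) (w u) ≤ 0
  have hF : ∀ t ∈ F, ∃ u : V, ∀ i, i ∈ t ↔ inner ℝ (z i) u ≤ 0 := fun t ht => by
    obtain ⟨u, hu⟩ := (Finset.mem_filter.1 ht).2
    exact ⟨w u, hu⟩
  have hvc : F.vcDim ≤ Module.finrank ℝ V := by
    refine Finset.sup_le fun s hs => ?_
    have := (linearIndepOn_of_shatters_halfspaces z hF (Finset.mem_shatterer.1 hs)).linearIndependent
    simpa using this.fintype_card_le_finrank
  have hcardF : F.card ≤ ∑ k ∈ Finset.Iic (Module.finrank ℝ V), n.choose k := by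
    refine (F.card_le_card_shatterer.trans Finset.card_shatterer_le_sum_vcDim).trans ?_
    rw [Fintype.card_fin]
    exact Finset.sum_le_sum_of_subset (Finset.Iic_subset_Iic.2 hvc)
  have hsub : (Set.range fun u => {i | z i ∈ {a | inner ℝ a (w u) ≤ 0}})
      ⊆ ((F.image fun t : Finset (Fin n) => (t : Set (Fin n)) : Finset (Set (Fin n))) :
        Set (Set (Fin n))) := by
    rintro _ ⟨u, rfl⟩
    simp only [Finset.coe_image, Set.mem_image, Finset.mem_coe]
    exact ⟨Finset.univ.filter fun i => inner ℝ (z i) (w u) ≤ 0,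
      Finset.mem_filter.2 ⟨Finset.mem_univ _, u, by simp⟩, by ext; simp⟩
  have hle := (Set.ncard_le_ncard hsub (Finset.finite_toSet _)).trans
    ((Set.ncard_coe_finset _).le.trans Finset.card_image_le) |>.trans hcardF
  refine le_trans ?_ (sum_choose_le_exp hV hVn)
  exact_mod_cast hle

namespace Probit

/-! ### The standard normal distribution function and the covariates -/

theorem Phi_eq_measureReal (t : ℝ) : Phi t = (gaussianReal 0 1).real (Set.Iic t) :=
  cdf_eq_real _ t

theorem Phi_pos (t : ℝ) : 0 < Phi t := by
  rw [Phi_eq_measureReal, measureReal_def, ENNReal.toReal_pos_iff]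
  refine ⟨pos_iff_ne_zero.2 fun h => ?_, measure_lt_top _ _⟩
  have := gaussianReal_absolutelyContinuous' 0 (one_ne_zero (α := NNReal)) h
  simp at this

theorem Phi_le_one (t : ℝ) : Phi t ≤ 1 := cdf_le_one _ t

theorem monotone_Phi : Monotone Phi := monotone_cdf _

theorem measurable_Phi : Measurable Phi := monotone_Phi.measurable

theorem Phi_neg (t : ℝ) : Phi (-t) = 1 - Phi t := by
  have : NullSingletonClass (gaussianReal 0 1) := nullSingletonClass_gaussianReal one_ne_zero
  have h : (gaussianReal 0 1).real (Set.Iic (-t)) = (gaussianReal 0 1).real (Set.Ici t) := by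
    have hmap := gaussianReal_map_neg (μ := 0) (v := 1)
    rw [neg_zero] at hmap
    rw [← congrArg (fun ρ : Measure ℝ => ρ.real (Set.Iic (-t))) hmap,
      map_measureReal_apply measurable_neg measurableSet_Iic]
    congr 1
    ext s
    simp
  rw [Phi_eq_measureReal, Phi_eq_measureReal, h, ← measureReal_congr (Iio_ae_eq_Iic (a := t)),
    ← probReal_compl_eq_one_sub measurableSet_Iio, Set.compl_Iio]

theorem Phi_neg_abs_le (t : ℝ) : Phi (-|t|) ≤ Phi t := monotone_Phi (neg_abs_le t)

theorem Phi_neg_abs_le_one_sub (t : ℝ) : Phi (-|t|) ≤ 1 - Phi t := by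
  rw [← Phi_neg]
  exact monotone_Phi (neg_le_neg (le_abs_self t))

theorem integrable_Phi_comp {X : Type*} [MeasurableSpace X] (ρ : Measure X) [IsFiniteMeasure ρ]
    {f : X → ℝ} (hf : Measurable f) : Integrable (fun a => Phi (f a)) ρ :=
  Integrable.of_bound (measurable_Phi.comp hf).aestronglyMeasurable 1
    (ae_of_all _ fun a => by
      rw [Real.norm_eq_abs, abs_of_pos (Phi_pos _)]; exact Phi_le_one _)

theorem hConst_pos (β₀ γ₀ : ℝ) : 0 < hConst β₀ γ₀ := by
  have hint : Integrable (fun z => Phi (-|β₀ + γ₀ * z|)) (gaussianReal 0 1) :=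
    integrable_Phi_comp _ (by fun_prop)
  rw [hConst, integral_pos_iff_support_of_nonneg (fun z => (Phi_pos _).le) hint]
  have : Function.support (fun z => Phi (-|β₀ + γ₀ * z|)) = Set.univ :=
    Set.eq_univ_of_forall fun z => (Phi_pos _).ne'
  rw [this]
  simp

theorem inner_consVec {d : ℕ} (a b : ℝ) (v w : EuclideanSpace ℝ (Fin d)) :
    inner ℝ (consVec a v) (consVec b w) = a * b + inner ℝ v w := by
  simp [consVec, PiLp.inner_apply, Fin.sum_univ_succ, mul_comm]

theorem measurable_withIntercept {d : ℕ} :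
    Measurable (withIntercept : EuclideanSpace ℝ (Fin d) → EuclideanSpace ℝ (Fin (d + 1))) := by
  unfold withIntercept consVec
  refine (WithLp.measurable_toLp 2 _).comp (measurable_pi_iff.2 fun j => ?_)
  refine Fin.cases ?_ (fun j => ?_) j
  · simp
  · simp only [Fin.cons_succ]
    fun_prop

/-- The conditional probability that the response lies in `B` when its covariate is `v`: the measure
of `B` under the law on `{-1, 1}` that gives mass `Φ(β₀ + v · β)` to `1`. -/
noncomputable def respProb {d : ℕ} (β₀ : ℝ) (β : EuclideanSpace ℝ (Fin d)) (B : Set ℝ)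
    (v : EuclideanSpace ℝ (Fin d)) : ℝ :=
  B.indicator (fun _ => (1 : ℝ)) 1 * Phi (β₀ + inner ℝ v β)
    + B.indicator (fun _ => (1 : ℝ)) (-1) * (1 - Phi (β₀ + inner ℝ v β))

theorem measurable_respProb {d : ℕ} (β₀ : ℝ) (β : EuclideanSpace ℝ (Fin d)) (B : Set ℝ) :
    Measurable (respProb β₀ β B) := by
  have h : Measurable fun v : EuclideanSpace ℝ (Fin d) => Phi (β₀ + inner ℝ v β) :=
    measurable_Phi.comp (by fun_prop)
  exact (h.const_mul _).add ((h.const_sub _).const_mul _)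

/-! ### The law of the observations -/

section Model

variable {Ω : Type*} [mΩ : MeasurableSpace Ω] {μ : Measure Ω} {n d : ℕ}
  {β₀ : ℝ} {β : EuclideanSpace ℝ (Fin d)} {x : Fin n → Ω → EuclideanSpace ℝ (Fin d)}
  {y : Fin n → Ω → ℝ}

theorem IsProbitModel.sigmaAlg_le (h : IsProbitModel μ β₀ β x y) : sigmaAlg x ≤ mΩ :=
  (measurable_pi_iff.2 h.measurable_x).comap_le

theorem IsProbitModel.condExp_preimage [IsProbabilityMeasure μ]
    (h : IsProbitModel μ β₀ β x y) (i : Fin n) (B : Set ℝ) :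
    μ⟦y i ⁻¹' B | sigmaAlg x⟧ =ᵐ[μ] fun ω => respProb β₀ β B (x i ω) := by
  have hm := h.sigmaAlg_le
  set f : Ω → ℝ := (y i ⁻¹' {1}).indicator fun _ => (1 : ℝ) with hf
  have hfi : Integrable f μ :=
    (integrable_const _).indicator (h.measurable_y i (measurableSet_singleton 1))
  set b₁ : ℝ := B.indicator (fun _ => (1 : ℝ)) 1
  set b₂ : ℝ := B.indicator (fun _ => (1 : ℝ)) (-1)
  have hdecomp : (y i ⁻¹' B).indicator (fun _ => (1 : ℝ))
      =ᵐ[μ] (b₁ - b₂) • f + fun _ => b₂ := by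
    filter_upwards [h.range_y i] with ω hω
    have h1 : (y i ⁻¹' B).indicator (fun _ => (1 : ℝ)) ω
      = B.indicator (fun _ => (1 : ℝ)) (y i ω) := rfl
    rcases hω with hω | hω
    · have : f ω = 0 := Set.indicator_of_notMem (by simp [hω]; norm_num) _
      simp [h1, hω, this, b₂]
    · have : f ω = 1 := Set.indicator_of_mem (by simp [hω]) _
      simp [h1, hω, this, b₁]
  filter_upwards [condExp_congr_ae (m := sigmaAlg x) hdecomp,
    condExp_add (hfi.smul (b₁ - b₂)) (integrable_const b₂) (sigmaAlg x),
    condExp_smul (μ := μ) (b₁ - b₂) f (sigmaAlg x), h.law_y i] with ω h1 h2 h3 h4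
  rw [h1, h2, Pi.add_apply, h3, condExp_const hm, Pi.smul_apply, h4]
  simp only [smul_eq_mul, respProb, withIntercept, inner_consVec, one_mul]
  ring

/-- The probability of a joint rectangle event factorizes over the observations: conditioning on the
covariates produces a product of functions of the individual `x_i`, which are independent. -/
theorem IsProbitModel.measureReal_inter_eq_prod [IsProbabilityMeasure μ]
    (h : IsProbitModel μ β₀ β x y)
    {A : Fin n → Set (EuclideanSpace ℝ (Fin d))} {B : Fin n → Set ℝ}
    (hA : ∀ i, MeasurableSet (A i)) (hB : ∀ i, MeasurableSet (B i)) :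
    μ.real ((⋂ i, x i ⁻¹' A i) ∩ ⋂ i, y i ⁻¹' B i)
      = ∏ i, ∫ ω, (A i).indicator (respProb β₀ β (B i)) (x i ω) ∂μ := by
  have hm := h.sigmaAlg_le
  have hR : MeasurableSet[sigmaAlg x] (⋂ i, x i ⁻¹' A i) := by
    refine ⟨Set.univ.pi A, MeasurableSet.univ_pi hA, ?_⟩
    ext ω; simp [Set.mem_pi]
  have hS : MeasurableSet (⋂ i, y i ⁻¹' B i) :=
    MeasurableSet.iInter fun i => h.measurable_y i (hB i)
  have hcond : μ⟦⋂ i, y i ⁻¹' B i | sigmaAlg x⟧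
      =ᵐ[μ] fun ω => ∏ i, respProb β₀ β (B i) (x i ω) := by
    have h1 := h.condIndep_y Finset.univ B hB
    simp only [Finset.mem_univ, Set.iInter_true] at h1
    filter_upwards [h1, ae_all_iff.2 fun i => h.condExp_preimage i (B i)] with ω h1 h2
    rw [h1, Finset.prod_apply]
    exact Finset.prod_congr rfl fun i _ => h2 i
  calc μ.real ((⋂ i, x i ⁻¹' A i) ∩ ⋂ i, y i ⁻¹' B i)
      = ∫ ω in ⋂ i, x i ⁻¹' A i, (⋂ i, y i ⁻¹' B i).indicator (fun _ => (1 : ℝ)) ω ∂μ := by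
        rw [integral_indicator_const _ hS, measureReal_restrict_apply hS, Set.inter_comm]
        simp
    _ = ∫ ω in ⋂ i, x i ⁻¹' A i, (μ⟦⋂ i, y i ⁻¹' B i | sigmaAlg x⟧) ω ∂μ :=
        (setIntegral_condExp hm ((integrable_const _).indicator hS) hR).symm
    _ = ∫ ω in ⋂ i, x i ⁻¹' A i, ∏ i, respProb β₀ β (B i) (x i ω) ∂μ :=
        setIntegral_congr_ae (hm _ hR) (hcond.mono fun ω hω _ => hω)
    _ = ∫ ω, ∏ i, (A i).indicator (respProb β₀ β (B i)) (x i ω) ∂μ := by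
        rw [← integral_indicator (hm _ hR)]
        congr 1 with ω
        by_cases hω : ∀ i, x i ω ∈ A i
        · rw [Set.indicator_of_mem (by simpa using hω)]
          exact Finset.prod_congr rfl fun i _ => (Set.indicator_of_mem (hω i) _).symm
        · rw [Set.indicator_of_notMem (by simpa using hω)]
          push Not at hω
          obtain ⟨i, hi⟩ := hω
          exact (Finset.prod_eq_zero (Finset.mem_univ i) (Set.indicator_of_notMem hi _)).symm
    _ = _ := h.indep_x.integral_fun_prod_comp (fun i => (h.measurable_x i).aemeasurable)
        fun i => ((measurable_respProb _ _ _).indicator (hA i)).aestronglyMeasurable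

theorem IsProbitModel.measureReal_pair [IsProbabilityMeasure μ]
    (h : IsProbitModel μ β₀ β x y) (i : Fin n)
    {A : Set (EuclideanSpace ℝ (Fin d))} {B : Set ℝ} (hA : MeasurableSet A) (hB : MeasurableSet B) :
    μ.real (x i ⁻¹' A ∩ y i ⁻¹' B) = ∫ ω, A.indicator (respProb β₀ β B) (x i ω) ∂μ := by
  have hm := h.sigmaAlg_le
  have hR : MeasurableSet[sigmaAlg x] (x i ⁻¹' A) :=
    ⟨(fun f : Fin n → _ => f i) ⁻¹' A, measurable_pi_apply i hA, rfl⟩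
  have hS : MeasurableSet (y i ⁻¹' B) := h.measurable_y i hB
  calc μ.real (x i ⁻¹' A ∩ y i ⁻¹' B)
      = ∫ ω in x i ⁻¹' A, (y i ⁻¹' B).indicator (fun _ => (1 : ℝ)) ω ∂μ := by
        rw [integral_indicator_const _ hS, measureReal_restrict_apply hS, Set.inter_comm]
        simp
    _ = ∫ ω in x i ⁻¹' A, (μ⟦y i ⁻¹' B | sigmaAlg x⟧) ω ∂μ :=
        (setIntegral_condExp hm ((integrable_const _).indicator hS) hR).symm
    _ = ∫ ω in x i ⁻¹' A, respProb β₀ β B (x i ω) ∂μ :=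
        setIntegral_congr_ae (hm _ hR) ((h.condExp_preimage i B).mono fun ω hω _ => hω)
    _ = _ := by
        rw [← integral_indicator (hm _ hR)]
        rfl

/-- The pairs `(x_i, y_i)` are independent. -/
theorem IsProbitModel.map_pair_eq_pi [IsProbabilityMeasure μ]
    (h : IsProbitModel μ β₀ β x y) :
    μ.map (fun ω i => (x i ω, y i ω)) = Measure.pi fun i => μ.map fun ω => (x i ω, y i ω) := by
  have hpair : ∀ i, Measurable fun ω => (x i ω, y i ω) := fun i =>
    (h.measurable_x i).prodMk (h.measurable_y i)
  have hprob : ∀ i, IsProbabilityMeasure (μ.map fun ω => (x i ω, y i ω)) := fun i =>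
    Measure.isProbabilityMeasure_map (hpair i).aemeasurable
  symm
  refine Measure.pi_eq_generateFrom (C := fun _ => Set.image2 (· ×ˢ ·)
    {s : Set (EuclideanSpace ℝ (Fin d)) | MeasurableSet s} {t : Set ℝ | MeasurableSet t})
    (fun _ => generateFrom_prod) (fun _ => isPiSystem_prod)
    (fun i => ⟨fun _ => Set.univ, fun _ => ⟨Set.univ, by simp, Set.univ, by simp,
      Set.univ_prod_univ⟩, fun _ => measure_lt_top _ _, Set.iUnion_const _⟩)
    fun s hs => ?_
  choose A hA B hB hAB using hs
  have hsm : ∀ i, MeasurableSet (s i) := fun i => by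
    rw [← hAB i]; exact MeasurableSet.prod (hA i) (hB i)
  rw [Measure.map_apply (measurable_pi_iff.2 hpair) (MeasurableSet.univ_pi hsm)]
  refine Eq.trans ?_ (Finset.prod_congr rfl fun i _ => (Measure.map_apply (hpair i) (hsm i)).symm)
  have h1 : (fun ω i => (x i ω, y i ω)) ⁻¹' Set.univ.pi s
      = (⋂ i, x i ⁻¹' A i) ∩ ⋂ i, y i ⁻¹' B i := by
    ext ω
    simp [Set.mem_pi, ← hAB, forall_and]
  have h2 : ∀ i, (fun ω => (x i ω, y i ω)) ⁻¹' s i = x i ⁻¹' A i ∩ y i ⁻¹' B i := fun i => by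
    rw [← hAB i]; rfl
  simp_rw [h1, h2]
  rw [← ENNReal.toReal_eq_toReal_iff' (measure_ne_top _ _)
    (ENNReal.prod_ne_top fun i _ => measure_ne_top _ _), ENNReal.toReal_prod]
  change μ.real _ = ∏ i, μ.real _
  rw [h.measureReal_inter_eq_prod hA hB]
  exact Finset.prod_congr rfl fun i _ => (h.measureReal_pair i (hA i) (hB i)).symm

theorem IsProbitModel.map_inner (h : IsProbitModel μ β₀ β x y) (i : Fin n) {γ₀ : ℝ}
    (hvar : γ₀ ^ 2 = variance (fun ω => inner ℝ (x i ω) β) μ) :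
    μ.map (fun ω => inner ℝ (x i ω) β) = (gaussianReal 0 1).map (γ₀ * ·) := by
  have hcomp : (fun ω => inner ℝ (x i ω) β) = innerSL ℝ β ∘ x i := by
    funext ω; simp [real_inner_comm]
  have hmL : Measurable (innerSL ℝ β) := (innerSL ℝ β).continuous.measurable
  have hv : γ₀ ^ 2 = Var[innerSL ℝ β; stdGaussian (EuclideanSpace ℝ (Fin d))] := by
    rw [hvar, hcomp, ← h.law_x i, variance_map hmL.aemeasurable (h.measurable_x i).aemeasurable]
  rw [hcomp, ← Measure.map_map hmL (h.measurable_x i), h.law_x i,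
    IsGaussian.map_eq_gaussianReal, integral_strongDual_stdGaussian, ← hv,
    gaussianReal_map_const_mul, mul_zero, mul_one]
  congr 1
  ext
  simp [sq_nonneg]

theorem IsProbitModel.integral_Phi_neg_abs [IsProbabilityMeasure μ]
    (h : IsProbitModel μ β₀ β x y) (i : Fin n) {γ₀ : ℝ}
    (hvar : γ₀ ^ 2 = variance (fun ω => inner ℝ (x i ω) β) μ) :
    ∫ ω, Phi (-|β₀ + inner ℝ (x i ω) β|) ∂μ = hConst β₀ γ₀ := by
  have hφ : Measurable fun s : ℝ => Phi (-|β₀ + s|) := measurable_Phi.comp (by fun_prop)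
  have hmx := h.measurable_x i
  rw [hConst, ← integral_map (φ := fun ω => inner ℝ (x i ω) β) (f := fun s => Phi (-|β₀ + s|))
    (by fun_prop) hφ.aestronglyMeasurable, h.map_inner i hvar,
    integral_map (by fun_prop) hφ.aestronglyMeasurable]

/-! ### The error probability of a direction -/

/-- The observations `(x, y)` that the direction `u` does not classify correctly with a positive
margin, `y x̄ · u ≤ 0`. -/
def errorSet {d : ℕ} (u : EuclideanSpace ℝ (Fin (d + 1))) : Set (EuclideanSpace ℝ (Fin d) × ℝ) :=
  {p | p.2 * inner ℝ (withIntercept p.1) u ≤ 0}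

theorem measurableSet_errorSet {d : ℕ} (u : EuclideanSpace ℝ (Fin (d + 1))) :
    MeasurableSet (errorSet u) := by
  have := measurable_withIntercept (d := d)
  exact measurableSet_le (by fun_prop) measurable_const

/-- No direction has error probability below `h`. The two disjoint events used, `x̄ · u ≥ 0` with
response `-1` and `x̄ · u < 0` with response `1`, have conditional probabilities `1 - Φ(η)` and
`Φ(η)`, both at least `Φ(-|η|)`. -/
theorem IsProbitModel.hConst_le_measureReal_errorSet [IsProbabilityMeasure μ]
    (h : IsProbitModel μ β₀ β x y) (i : Fin n)
    {γ₀ : ℝ} (hvar : γ₀ ^ 2 = variance (fun ω => inner ℝ (x i ω) β) μ)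
    (u : EuclideanSpace ℝ (Fin (d + 1))) :
    hConst β₀ γ₀ ≤ (μ.map fun ω => (x i ω, y i ω)).real (errorSet u) := by
  have hmx := h.measurable_x i
  have hmy := h.measurable_y i
  rw [map_measureReal_apply (hmx.prodMk hmy) (measurableSet_errorSet u)]
  set P : Set (EuclideanSpace ℝ (Fin d)) := {v | 0 ≤ inner ℝ (withIntercept v) u} with hP
  have hPm : MeasurableSet P := by
    have := measurable_withIntercept (d := d)
    exact measurableSet_le measurable_const (by fun_prop)
  have hdisj : Disjoint (x i ⁻¹' P ∩ y i ⁻¹' {-1}) (x i ⁻¹' Pᶜ ∩ y i ⁻¹' {1}) :=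
    Set.disjoint_left.2 fun ω hω hω' => hω'.1 hω.1
  have hsub : (x i ⁻¹' P ∩ y i ⁻¹' {-1}) ∪ (x i ⁻¹' Pᶜ ∩ y i ⁻¹' {1})
      ⊆ (fun ω => (x i ω, y i ω)) ⁻¹' errorSet u := by
    rintro ω (⟨h1, h2⟩ | ⟨h1, h2⟩)
    · have h1 : 0 ≤ inner ℝ (withIntercept (x i ω)) u := h1
      have h2 : y i ω = -1 := h2
      simpa [errorSet, h2] using h1
    · have h1 : ¬ 0 ≤ inner ℝ (withIntercept (x i ω)) u := h1
      have h2 : y i ω = 1 := h2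
      simpa [errorSet, h2] using (not_le.1 h1).le
  refine le_trans ?_ (measureReal_mono hsub)
  rw [measureReal_union hdisj ((hmx hPm.compl).inter (hmy (measurableSet_singleton _))),
    h.measureReal_pair i hPm (measurableSet_singleton _),
    h.measureReal_pair i hPm.compl (measurableSet_singleton _), ← h.integral_Phi_neg_abs i hvar]
  have hΦ : Integrable (fun ω => Phi (β₀ + inner ℝ (x i ω) β)) μ :=
    integrable_Phi_comp _ (by fun_prop)
  have hint : ∀ b : ℝ, Integrable (fun ω => respProb β₀ β {b} (x i ω)) μ := fun b =>
    (hΦ.const_mul _).add (((integrable_const _).sub hΦ).const_mul _)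
  have hint1 : Integrable (fun ω => P.indicator (respProb β₀ β {-1}) (x i ω)) μ :=
    (hint (-1)).indicator (hmx hPm)
  have hint2 : Integrable (fun ω => Pᶜ.indicator (respProb β₀ β {1}) (x i ω)) μ :=
    (hint 1).indicator (hmx hPm.compl)
  rw [← integral_add hint1 hint2]
  refine integral_mono (integrable_Phi_comp _ (by fun_prop)) (hint1.add hint2) fun ω => ?_
  have hne : (1 : ℝ) ≠ -1 := by norm_num
  by_cases hω : x i ω ∈ P
  · simpa [hω, respProb, hne] using Phi_neg_abs_le_one_sub _
  · simpa [hω, respProb, hne.symm] using Phi_neg_abs_le _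

end Model

/-- Directions in a dense sequence do as well as any direction: a strict inequality
`c_i (z_i · u) > 0` persists near `u`, so the number of errors does not increase there. -/
theorem exists_denseSeq_sum_indicator_le {V : Type*} [NormedAddCommGroup V] [InnerProductSpace ℝ V]
    {n : ℕ} (z : Fin n → V) (c : Fin n → ℝ) {S : Set V} {w : ℕ → S} (hw : DenseRange w) (u : S) :
    ∃ k, ∑ i, (Set.Iic (0 : ℝ)).indicator (fun _ => (1 : ℝ)) (c i * inner ℝ (z i) (w k : V))
      ≤ ∑ i, (Set.Iic (0 : ℝ)).indicator (fun _ => (1 : ℝ)) (c i * inner ℝ (z i) (u : V)) := by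
  have hopen : IsOpen {v : S | ∀ i, 0 < c i * inner ℝ (z i) (u : V) →
      0 < c i * inner ℝ (z i) (v : V)} := by
    simp only [Set.ofPred_forall]
    refine isOpen_iInter_of_finite fun i => isOpen_iInter_of_finite fun _ => ?_
    exact isOpen_lt continuous_const (by fun_prop)
  obtain ⟨k, hk⟩ := hw.exists_mem_open hopen ⟨u, fun _ hi => hi⟩
  refine ⟨k, Finset.sum_le_sum fun i _ => ?_⟩
  by_cases hi : c i * inner ℝ (z i) (u : V) ≤ 0
  · rw [Set.indicator_of_mem (Set.mem_Iic.2 hi)]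
    exact Set.indicator_le_self' (fun _ _ => zero_le_one) _
  · rw [Set.indicator_of_notMem (by simpa using hk i (not_le.1 hi))]
    exact Set.indicator_nonneg (fun _ _ => zero_le_one) _

end Probit

/-! ### The lower bound on the minimal number of errors -/

theorem theorem2p5 {Ω : Type*} [MeasurableSpace Ω] (μ : Measure Ω) [IsProbabilityMeasure μ]
    (n d : ℕ) (hnd : d < n)
    (β₀ : ℝ) (β : EuclideanSpace ℝ (Fin d))
    (x : Fin n → Ω → EuclideanSpace ℝ (Fin d)) (y : Fin n → Ω → ℝ)
    (hmodel : Probit.IsProbitModel μ β₀ β x y)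
    (γ₀ : ℝ) (hγ₀ : 0 ≤ γ₀) (hvar : ∀ i, γ₀ ^ 2 = variance (fun ω => inner ℝ (x i ω) β) μ) :
    0 < Probit.hConst β₀ γ₀ ∧
    ∀ ε : ℝ, 0 < ε →
      1 - Real.exp (-2 * ε ^ 2 * n) ≤
        μ.real {ω |
          (n : ℝ) * (Probit.hConst β₀ γ₀ - ε -
              Real.sqrt (2 * Real.log (Real.exp 1 * n / (d + 1)) / ((n : ℝ) / (d + 1)))) ≤
            Probit.sStar (fun i => Probit.withIntercept (x i ω)) (fun i => y i ω)} := by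
  refine ⟨Probit.hConst_pos β₀ γ₀, fun ε hε => ?_⟩
  have hn : 0 < n := by omega
  have hnR : (0 : ℝ) < n := by exact_mod_cast hn
  have hdn : (d : ℝ) + 1 ≤ n := by exact_mod_cast hnd
  set Sph := Metric.sphere (0 : EuclideanSpace ℝ (Fin (d + 1))) 1
  have hSph : Nonempty Sph :=
    (NormedSpace.sphere_nonempty (x := (0 : EuclideanSpace ℝ (Fin (d + 1))))
      (r := 1)).2 zero_le_one |>.to_subtype
  set w : ℕ → Sph := TopologicalSpace.denseSeq Sph
  have hw : DenseRange w := TopologicalSpace.denseRange_denseSeq Sph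
  let ν : Fin n → Measure (EuclideanSpace ℝ (Fin d) × ℝ) := fun i => μ.map fun ω => (x i ω, y i ω)
  have hpair : ∀ i, Measurable fun ω => (x i ω, y i ω) := fun i =>
    (hmodel.measurable_x i).prodMk (hmodel.measurable_y i)
  have hν : ∀ i, IsProbabilityMeasure (ν i) := fun i =>
    Measure.isProbabilityMeasure_map (hpair i).aemeasurable
  have hA : ∀ k, MeasurableSet (Probit.errorSet (w k : EuclideanSpace ℝ (Fin (d + 1)))) := fun k =>
    Probit.measurableSet_errorSet _
  set K : ℝ := (d + 1) * Real.log (Real.exp 1 * n / (d + 1)) with hK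
  have hK0 : 0 < K := by
    refine mul_pos (by positivity) (Real.log_pos ?_)
    rw [one_lt_div (by positivity)]
    have h1 : 1 < Real.exp 1 := Real.one_lt_exp_iff.2 one_pos
    nlinarith
  have hcard : ∀ p : Fin n → EuclideanSpace ℝ (Fin d) × ℝ,
      ((Set.range fun k => {i | p i ∈ Probit.errorSet
        (w k : EuclideanSpace ℝ (Fin (d + 1)))}).ncard : ℝ) ≤ Real.exp K := by
    intro p
    have := ncard_halfspace_patterns_le (V := EuclideanSpace ℝ (Fin (d + 1))) (n := n)
      (by simp) (by simpa using hnd) (fun k => (w k : EuclideanSpace ℝ (Fin (d + 1))))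
      (fun i => (p i).2 • Probit.withIntercept (p i).1)
    simpa [hK, Probit.errorSet, inner_smul_left] using this
  have hdev := measureReal_exists_sum_indicator_lt_le ν hn hA hK0 hcard hε.le
  set W : Set (Fin n → EuclideanSpace ℝ (Fin d) × ℝ) := {z | ∃ k,
    ∑ i, (Probit.errorSet (w k : EuclideanSpace ℝ (Fin (d + 1)))).indicator
        (fun _ => (1 : ℝ)) (z i)
      < ∑ i, (ν i).real (Probit.errorSet (w k : EuclideanSpace ℝ (Fin (d + 1))))
        - n * ε - Real.sqrt (2 * n * K)} with hW
  have hWm : MeasurableSet W := by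
    rw [hW, Set.ofPred_exists]
    refine MeasurableSet.iUnion fun k => measurableSet_lt (Finset.measurable_sum _ fun i _ => ?_)
      measurable_const
    exact (measurable_const.indicator (hA k)).comp (measurable_pi_apply i)
  have hmeas : Measurable fun ω i => (x i ω, y i ω) := measurable_pi_iff.2 hpair
  rw [← hmodel.map_pair_eq_pi, map_measureReal_apply hmeas hWm] at hdev
  have hcompl := probReal_compl_eq_one_sub (μ := μ) (hmeas hWm)
  have hsqrt : (n : ℝ) * Real.sqrt (2 * Real.log (Real.exp 1 * n / (d + 1)) / ((n : ℝ) / (d + 1)))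
      = Real.sqrt (2 * n * K) := by
    rw [← Real.sqrt_sq hnR.le, ← Real.sqrt_mul (sq_nonneg _), Real.sqrt_sq hnR.le]
    congr 1
    rw [hK]
    field_simp
  have hgood : ((fun ω i => (x i ω, y i ω)) ⁻¹' W)ᶜ ⊆ {ω |
      (n : ℝ) * (Probit.hConst β₀ γ₀ - ε -
        Real.sqrt (2 * Real.log (Real.exp 1 * n / (d + 1)) / ((n : ℝ) / (d + 1)))) ≤
          Probit.sStar (fun i => Probit.withIntercept (x i ω)) (fun i => y i ω)} := by
    intro ω hω
    change _ ≤ Probit.sStar _ _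
    unfold Probit.sStar
    refine le_ciInf fun u => ?_
    obtain ⟨k, hk⟩ := Probit.exists_denseSeq_sum_indicator_le
      (fun i => Probit.withIntercept (x i ω)) (fun i => y i ω) hw u
    refine le_trans ?_ hk
    have hωk := not_lt.1 fun hlt => hω ⟨k, hlt⟩
    have hsum : n * Probit.hConst β₀ γ₀ ≤
        ∑ i, (ν i).real (Probit.errorSet (w k : EuclideanSpace ℝ (Fin (d + 1)))) := by
      have := Finset.card_nsmul_le_sum Finset.univ
        (fun i => (ν i).real (Probit.errorSet (w k : EuclideanSpace ℝ (Fin (d + 1)))))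
        (Probit.hConst β₀ γ₀)
        fun i _ => hmodel.hConst_le_measureReal_errorSet i (hvar i) _
      simpa using this
    rw [mul_sub, mul_sub, hsqrt]
    exact le_trans (by linarith) hωk
  have := measureReal_mono (μ := μ) hgood
  linarith
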